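/- Let $\Gamma$ be a finite connected graph (loops and multiple edges allowed), let $f\colon\Gamma\to\Gamma$ be a homotopy equivalence that sends vertices to vertices and each edge across an edge-path, let $*$ be a vertex with $f(*)=*$, and let $H\subseteq\Gamma$ be a subgraph with $f(H)\subseteq H$. Put $\mathbb F=\pi_1(\Gamma,*)$, let $\Phi_f\in\mathrm{Aut}(\mathbb F)$ be the automorphism induced by $f$, and let $G_\phi=\mathbb F\rtimes_{\Phi_f}\langle t\rangle=\langle \mathbb F,t\mid t^{-1}xt=\Phi_f(x)\ (x\in\mathbb F)\rangle$. Let $\widetilde\Gamma$ be the universal cover of $\Gamma$, let $\widetilde H$ be the preimage of $H$, let $\tilde f$ be the lift of $f$ that fixes a chosen lift of $*$, let $C_1(\widetilde\Gamma,\widetilde H;\mathbb Q)$ be the $\mathbb Q[\mathbb F]$-module of rational cellular $1$-chains of $\widetilde\Gamma$ whose coefficients vanish on the edges of $\widetilde H$, and let $\pi_H^\perp$ be the projection of $C_1(\widetilde\Gamma;\mathbb Q)$ onto it that forgets the coefficients on the edges of $\widetilde H$. For vertices $u,v$ of $\widetilde\Gamma$ let $[u,v]$ be the unique $1$-chain with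 boundary $v-u$. A *Nielsen $1$-chain* is a chain $\rho=\pi_H^\perp([u,v])$, where $\tilde f(u)=u$ and $\tilde f(v)=v$, that is non-geometric or geometric. It is *non-geometric* if there is an edge $e$ of $\widetilde\Gamma$ outside $\widetilde H$ with $\rho_e=\pm1$ and $\rho_{ge}=0$ for all $1\neq g\in\mathbb F$. It is *geometric* if (i) for distinct $g_1,g_2\in\mathbb F$ the set $\mathrm{supp}(g_1\rho)\cap\mathrm{supp}(g_2\rho)$ is empty or a single edge; (ii) for each edge $e$ of $\widetilde\Gamma$ outside $\widetilde H$ there is exactly one unordered pair of distinct elements $g_1,g_2\in\mathbb F$ with $\mathrm{supp}(g_1\rho)\cap\mathrm{supp}(g_2\rho)=\{e\}$; (iii) there are non-commuting $g_1,g_2\in\mathbb F$ such that $\mathrm{supp}(\rho)$ meets both $\mathrm{supp}(g_1\rho)$ and $\mathrm{supp}(g_2\rho)$. Let $V_{\rm qf}\subseteq C_1(\widetilde\Gamma,\widetilde H;\mathbb Q)$ be a $\mathbb Q[\mathbb F]$-submodule that is zero or generated by a Nielsen $1$-chain. Let $n_H$ be the number of edges of $\Gamma$ outside $H$. A choice of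 one lift to $\widetilde\Gamma$ of each of these edges identifies $C_1(\widetilde\Gamma,\widetilde H;\mathbb Q)$ with $\mathbb Q[\mathbb F]^{n_H}\subseteq L^2(\mathbb F)^{n_H}\subseteq L^2(G_\phi)^{n_H}$. Let $V_{\rm qf}^{(2)}$ be the closure in $L^2(\mathbb F)^{n_H}$ of the complex span of $V_{\rm qf}$, and let $W_{\rm qf}^{(2)}=\iota_*V_{\rm qf}^{(2)}$ be the closure in $L^2(G_\phi)^{n_H}$ of $\bigoplus_{\ell\in\mathbb Z}t^\ell V_{\rm qf}^{(2)}$. If $W_{\rm qf}^{(2)}\neq\{0\}$, then $W_{\rm qf}^{(2)}$ is isomorphic to $L^2(G_\phi)$ as a Hilbert-$G_\phi$-module, that is, there is a $G_\phi$-equivariant bounded linear bijection $L^2(G_\phi)\to W_{\rm qf}^{(2)}$ with bounded inverse. Moreover, if $\rho$ is a Nielsen $1$-chain that generates $V_{\rm qf}$, then the map $\mathbb Q[\mathbb F]\to V_{\rm qf}$, $q\mapsto q\rho$, extends to an $\mathbb F$-equivariant bounded linear bijection $O\colon L^2(\mathbb F)\to V_{\rm qf}^{(2)}$ with bounded inverse,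 and there is a constant $D\ge1$ with $D^{-1}\|\xi\|\le\|O(\xi)\|\le D\|\xi\|$ for all $\xi\in L^2(\mathbb F)$. -/

import Mathlib

/-! ### Graphs, edge-paths and the fundamental group -/

/-- A graph (1-dimensional CW-complex) with vertex set `V` and edge set `E`; each edge `e` is
oriented, with initial vertex `o e` and terminal vertex `t e`. Loops and multiple edges are
allowed. -/
structure CellGraph (V E : Type*) where
  o : E → V
  t : E → V

namespace CellGraph

variable {V E : Type*} (Γ : CellGraph V E)

/-- Initial vertex of an oriented edge: `(e, true)` is `e`, `(e, false)` is the reversed edge. -/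
def src (x : E × Bool) : V := if x.2 then Γ.o x.1 else Γ.t x.1

/-- Terminal vertex of an oriented edge. -/
def tgt (x : E × Bool) : V := if x.2 then Γ.t x.1 else Γ.o x.1

/-- `Γ.IsEdgePath a L b`: the list `L` of oriented edges is an edge-path from `a` to `b`
(not necessarily reduced, possibly trivial). -/
def IsEdgePath : V → List (E × Bool) → V → Prop
  | a, [], b => a = b
  | a, x :: L, b => Γ.src x = a ∧ IsEdgePath (Γ.tgt x) L b

/-- `Γ` is connected (and non-empty as soon as a base vertex is given). -/
def Connected : Prop := ∀ a b, ∃ L, Γ.IsEdgePath a L b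

/-- The homotopy classes, relative to the endpoints, of edge-paths from `a` to `b`. Two edge-paths
with the same endpoints are homotopic if and only if they become equal after cancelling
backtracks, that is, if and only if they define the same element of the free group on `E`; the
class of an edge-path is recorded as that element. -/
def PathClass (a b : V) : Set (FreeGroup E) :=
  {w | ∃ L, Γ.IsEdgePath a L b ∧ FreeGroup.mk L = w}

variable {Γ}

theorem IsEdgePath.append {a b c : V} {L M : List (E × Bool)} (h : Γ.IsEdgePath a L b)
    (h' : Γ.IsEdgePath b M c) : Γ.IsEdgePath a (L ++ M) c := by
  induction L generalizing a with
  | nil => cases h; exact h'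
  | cons x L ih => exact ⟨h.1, ih h.2⟩

theorem IsEdgePath.invRev {a b : V} {L : List (E × Bool)} (h : Γ.IsEdgePath a L b) :
    Γ.IsEdgePath b (FreeGroup.invRev L) a := by
  induction L generalizing a with
  | nil => cases h; rfl
  | cons x L ih =>
    have h1 : FreeGroup.invRev (x :: L) = FreeGroup.invRev L ++ [(x.1, !x.2)] := by
      simp [FreeGroup.invRev]
    rw [h1]
    refine (ih h.2).append ⟨?_, ?_⟩
    · rcases x with ⟨e, _ | _⟩ <;> rfl
    · have := h.1
      rcases x with ⟨e, _ | _⟩ <;> exact this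

theorem PathClass.one_mem (a : V) : (1 : FreeGroup E) ∈ Γ.PathClass a a := ⟨[], rfl, rfl⟩

theorem PathClass.mul_mem {a b c : V} {w z : FreeGroup E} (hw : w ∈ Γ.PathClass a b)
    (hz : z ∈ Γ.PathClass b c) : w * z ∈ Γ.PathClass a c := by
  obtain ⟨L, hL, rfl⟩ := hw
  obtain ⟨M, hM, rfl⟩ := hz
  exact ⟨L ++ M, hL.append hM, FreeGroup.mul_mk.symm⟩

theorem PathClass.inv_mem {a b : V} {w : FreeGroup E} (hw : w ∈ Γ.PathClass a b) :
    w⁻¹ ∈ Γ.PathClass b a := by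
  obtain ⟨L, hL, rfl⟩ := hw
  exact ⟨FreeGroup.invRev L, hL.invRev, FreeGroup.inv_mk.symm⟩

theorem PathClass.edge_mem (e : E) : FreeGroup.of e ∈ Γ.PathClass (Γ.o e) (Γ.t e) :=
  ⟨[(e, true)], ⟨rfl, rfl⟩, rfl⟩

variable (Γ)

/-- The fundamental group of `Γ` at `a`: homotopy classes of closed edge-paths at `a`, multiplied
by concatenation. -/
def π₁ (a : V) : Subgroup (FreeGroup E) where
  carrier := Γ.PathClass a a
  mul_mem' := PathClass.mul_mem
  one_mem' := PathClass.one_mem a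
  inv_mem' := PathClass.inv_mem

/-- A subgraph: a set of vertices and a set of edges that contains the endpoints of its edges. -/
structure Subgraph where
  verts : Set V
  edges : Set E
  o_mem : ∀ e ∈ edges, Γ.o e ∈ verts
  t_mem : ∀ e ∈ edges, Γ.t e ∈ verts

/-- A cellular self-map of `Γ`, up to parametrization of the edges: vertices go to vertices, and
each edge goes across an edge-path (which may be trivial). -/
structure SelfMap where
  onV : V → V
  onE : E → List (E × Bool)
  isEdgePath : ∀ e, Γ.IsEdgePath (onV (Γ.o e)) (onE e) (onV (Γ.t e))

namespace SelfMap

variable {Γ}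

/-- The effect of a self-map on (classes of) edge-paths. -/
def onPaths (f : Γ.SelfMap) : FreeGroup E →* FreeGroup E :=
  FreeGroup.lift fun e => FreeGroup.mk (f.onE e)

theorem onPaths_mem (f : Γ.SelfMap) {a b : V} {w : FreeGroup E} (hw : w ∈ Γ.PathClass a b) :
    f.onPaths w ∈ Γ.PathClass (f.onV a) (f.onV b) := by
  obtain ⟨L, hL, rfl⟩ := hw
  induction L generalizing a with
  | nil => cases hL; exact PathClass.one_mem _
  | cons x L ih =>
    have h1 : (FreeGroup.mk (x :: L) : FreeGroup E) = FreeGroup.mk [x] * FreeGroup.mk L := by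
      rw [FreeGroup.mul_mk]; rfl
    rw [h1, map_mul]
    refine PathClass.mul_mem ?_ (ih hL.2)
    have he := PathClass.inv_mem (Γ := Γ) ⟨_, f.isEdgePath x.1, rfl⟩
    obtain ⟨rfl, -⟩ := hL
    rcases x with ⟨e, _ | _⟩
    · simpa [onPaths, src, tgt] using he
    · have he' : FreeGroup.mk (f.onE e) ∈ Γ.PathClass (f.onV (Γ.o e)) (f.onV (Γ.t e)) :=
        ⟨_, f.isEdgePath e, rfl⟩
      simpa [onPaths, src, tgt] using he'

/-- `h ∘ f` is homotopic to the identity: there are edge-paths `γ v` from `v` to `h (f v)` (the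
tracks of the vertices) such that for every edge `e` the path `h (f e)` is homotopic to
`(γ (o e))⁻¹ · e · γ (t e)`. -/
def CompHomotopicId (h f : Γ.SelfMap) : Prop :=
  ∃ γ : V → FreeGroup E, (∀ v, γ v ∈ Γ.PathClass v (h.onV (f.onV v))) ∧
    ∀ e, h.onPaths (f.onPaths (FreeGroup.of e)) = (γ (Γ.o e))⁻¹ * FreeGroup.of e * γ (Γ.t e)

/-- `f` is a homotopy equivalence. -/
def IsHomotopyEquivalence (f : Γ.SelfMap) : Prop :=
  ∃ h : Γ.SelfMap, CompHomotopicId h f ∧ CompHomotopicId f h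

theorem CompHomotopicId.exists_conj {h f : Γ.SelfMap} (H : CompHomotopicId h f) :
    ∃ γ : V → FreeGroup E, (∀ v, γ v ∈ Γ.PathClass v (h.onV (f.onV v))) ∧
      ∀ a b, ∀ w ∈ Γ.PathClass a b, h.onPaths (f.onPaths w) = (γ a)⁻¹ * w * γ b := by
  obtain ⟨γ, hγ, he⟩ := H
  refine ⟨γ, hγ, ?_⟩
  rintro a b w ⟨L, hL, rfl⟩
  induction L generalizing a with
  | nil =>
    cases hL
    rw [← FreeGroup.one_eq_mk]; simp
  | cons x L ih =>
    have h1 : (FreeGroup.mk (x :: L) : FreeGroup E) = FreeGroup.mk [x] * FreeGroup.mk L := by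
      rw [FreeGroup.mul_mk]; rfl
    obtain ⟨rfl, hL⟩ := hL
    rw [h1, map_mul, map_mul, ih _ hL]
    rcases x with ⟨e, _ | _⟩
    · have h2 : (FreeGroup.mk [(e, false)] : FreeGroup E) = (FreeGroup.of e)⁻¹ := rfl
      rw [h2, map_inv, map_inv, he e]
      simp [src, tgt, mul_assoc]
    · have h2 : (FreeGroup.mk [(e, true)] : FreeGroup E) = FreeGroup.of e := rfl
      rw [h2, he e]
      simp [src, tgt, mul_assoc]

/-- The endomorphism of the fundamental group at a fixed vertex (and the trivial path there). -/
def onπ₁ (f : Γ.SelfMap) {a : V} (ha : f.onV a = a) : Γ.π₁ a →* Γ.π₁ a where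
  toFun g := ⟨f.onPaths g, by have := f.onPaths_mem g.2; rwa [ha] at this⟩
  map_one' := by ext; simp
  map_mul' x y := by ext; simp

theorem onπ₁_bijective (f : Γ.SelfMap) (hf : f.IsHomotopyEquivalence) {a : V}
    (ha : f.onV a = a) : Function.Bijective (f.onπ₁ ha) := by
  obtain ⟨h, h1, h2⟩ := hf
  obtain ⟨γ, hγ, h1⟩ := h1.exists_conj
  obtain ⟨δ, -, h2⟩ := h2.exists_conj
  constructor
  · rw [injective_iff_map_eq_one]
    rintro ⟨w, hw⟩ hw1
    have hw1 : f.onPaths w = 1 := congrArg Subtype.val hw1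
    have h3 := h1 a a w hw
    rw [hw1, map_one] at h3
    ext
    have h4 : w = γ a * ((γ a)⁻¹ * w * γ a) * (γ a)⁻¹ := by group
    rw [← h3] at h4
    simpa using h4
  · rintro ⟨w, hw⟩
    have hw' : w ∈ Γ.PathClass (f.onV a) (f.onV a) := by rw [ha]; exact hw
    have hhw := h.onPaths_mem hw'
    have hz : γ a * h.onPaths w * (γ a)⁻¹ ∈ Γ.PathClass a a :=
      PathClass.mul_mem (PathClass.mul_mem (hγ a) hhw) (PathClass.inv_mem (hγ a))
    refine ⟨⟨_, hz⟩, ?_⟩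
    ext
    change f.onPaths _ = w
    have h3 := h1 a a _ hz
    have h4 : h.onPaths (f.onPaths (γ a * h.onPaths w * (γ a)⁻¹)) = h.onPaths w := by
      rw [h3]; group
    have hfz := f.onPaths_mem hz
    have h5 := h2 _ _ _ hfz
    rw [h4, h2 _ _ _ hw'] at h5
    exact (mul_left_cancel (mul_right_cancel h5)).symm

/-- The automorphism `Φ_f` of the fundamental group at a fixed vertex induced by a homotopy
equivalence. -/
noncomputable def inducedAut (f : Γ.SelfMap) (hf : f.IsHomotopyEquivalence) {a : V}
    (ha : f.onV a = a) : MulAut (Γ.π₁ a) :=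
  MulEquiv.ofBijective (f.onπ₁ ha) (f.onπ₁_bijective hf ha)

/-- `H` is `f`-invariant: `f H ⊆ H`. -/
def Preserves (f : Γ.SelfMap) (H : Γ.Subgraph) : Prop :=
  (∀ v ∈ H.verts, f.onV v ∈ H.verts) ∧ ∀ e ∈ H.edges, ∀ x ∈ f.onE e, x.1 ∈ H.edges

end SelfMap

/-! ### The universal cover and its cellular chains -/

/-- Vertices of the universal cover of `Γ` (based at `a`): pairs of a vertex `v` of `Γ` and a
homotopy class of edge-paths from `a` to `v`. -/
def CoverVertex (a : V) : Type _ := {x : V × FreeGroup E // x.2 ∈ Γ.PathClass a x.1}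

/-- Edges of the universal cover: pairs of an edge `e` of `Γ` and a homotopy class of edge-paths
from `a` to the initial vertex of `e`. -/
def CoverEdge (a : V) : Type _ := {x : E × FreeGroup E // x.2 ∈ Γ.PathClass a (Γ.o x.1)}

variable {Γ} {a : V}

/-- The edge of `Γ` below an edge of the universal cover. -/
def CoverEdge.proj (e : Γ.CoverEdge a) : E := e.1.1

/-- Initial vertex of an edge of the universal cover. -/
def CoverEdge.o (e : Γ.CoverEdge a) : Γ.CoverVertex a := ⟨(Γ.o e.1.1, e.1.2), e.2⟩

/-- Terminal vertex of an edge of the universal cover. -/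
def CoverEdge.t (e : Γ.CoverEdge a) : Γ.CoverVertex a :=
  ⟨(Γ.t e.1.1, e.1.2 * FreeGroup.of e.1.1), PathClass.mul_mem e.2 (PathClass.edge_mem _)⟩

/-- The deck action of the fundamental group on the edges of the universal cover. -/
instance : MulAction (Γ.π₁ a) (Γ.CoverEdge a) where
  smul g e := ⟨(e.1.1, g * e.1.2), PathClass.mul_mem g.2 e.2⟩
  one_smul _ := Subtype.ext (Prod.ext rfl (one_mul _))
  mul_smul _ _ _ := Subtype.ext (Prod.ext rfl (mul_assoc _ _ _))

/-- The action on edges is free. -/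
theorem CoverEdge.smul_left_injective (e : Γ.CoverEdge a) :
    Function.Injective fun g : Γ.π₁ a => g • e := by
  intro g h hgh
  have h1 : (g : FreeGroup E) * e.1.2 = h * e.1.2 :=
    congrArg (fun x : Γ.CoverEdge a => x.1.2) hgh
  exact Subtype.ext (mul_right_cancel h1)

/-- The lift of `f` to the universal cover that fixes the base vertex, on vertices. -/
def SelfMap.lift (f : Γ.SelfMap) (ha : f.onV a = a) (u : Γ.CoverVertex a) : Γ.CoverVertex a :=
  ⟨(f.onV u.1.1, f.onPaths u.1.2), by have := f.onPaths_mem u.2; rwa [ha] at this⟩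

variable (Γ a) in
/-- Rational cellular 1-chains of the universal cover. -/
abbrev Chain₁ : Type _ := Γ.CoverEdge a →₀ ℚ

variable (Γ a) in
/-- Rational cellular 0-chains of the universal cover. -/
abbrev Chain₀ : Type _ := Γ.CoverVertex a →₀ ℚ

/-- The cellular boundary map, `∂ e = t e - o e`. -/
noncomputable def boundary : Γ.Chain₁ a →ₗ[ℚ] Γ.Chain₀ a :=
  Finsupp.linearCombination ℚ fun e : Γ.CoverEdge a =>
    Finsupp.single e.t 1 - Finsupp.single e.o 1

/-- The translate `g x` of a 1-chain: `(g x)_{g e} = x_e`. -/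
noncomputable def translate (g : Γ.π₁ a) : Γ.Chain₁ a →ₗ[ℚ] Γ.Chain₁ a :=
  Finsupp.lmapDomain ℚ ℚ fun e : Γ.CoverEdge a => g • e

/-- The support of a 1-chain. -/
def supp (x : Γ.Chain₁ a) : Set (Γ.CoverEdge a) := {e | x e ≠ 0}

/-- The edges of the universal cover that do not lie over `H`. -/
def outside (a : V) (H : Γ.Subgraph) : Set (Γ.CoverEdge a) := {e | e.proj ∉ H.edges}

/-- The 1-chains relative to the preimage of `H`, as the chains supported outside it. -/
def relChains (a : V) (H : Γ.Subgraph) : Submodule ℚ (Γ.Chain₁ a) :=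
  Finsupp.supported ℚ ℚ (outside a H)

open Classical in
/-- The projection onto the relative 1-chains that forgets the coefficients over `H`. -/
noncomputable def projRel (H : Γ.Subgraph) (x : Γ.Chain₁ a) : Γ.Chain₁ a :=
  x.filter fun e => e ∈ outside a H

/-! ### Nielsen 1-chains -/

/-- `ρ` is the relative part of the 1-chain `[u, v]` (the 1-chain `c` with `∂ c = v - u`, unique
as the universal cover is a tree) for vertices `u`, `v` that are fixed by the lift of `f`. -/
def IsFixedSegment (f : Γ.SelfMap) (ha : f.onV a = a) (H : Γ.Subgraph) (ρ : Γ.Chain₁ a) : Prop :=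
  ∃ (u v : Γ.CoverVertex a) (c : Γ.Chain₁ a),
    f.lift ha u = u ∧ f.lift ha v = v ∧
    boundary c = Finsupp.single v 1 - Finsupp.single u 1 ∧ ρ = projRel H c

/-- The condition on a non-geometric Nielsen 1-chain. -/
def IsNonGeometric (H : Γ.Subgraph) (ρ : Γ.Chain₁ a) : Prop :=
  ∃ e ∈ outside a H, (ρ e = 1 ∨ ρ e = -1) ∧ ∀ g : Γ.π₁ a, g ≠ 1 → ρ (g • e) = 0

/-- The three conditions on a geometric Nielsen 1-chain. -/
structure IsGeometric (H : Γ.Subgraph) (ρ : Γ.Chain₁ a) : Prop where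
  single : ∀ g₁ g₂ : Γ.π₁ a, g₁ ≠ g₂ →
    supp (translate g₁ ρ) ∩ supp (translate g₂ ρ) = ∅ ∨
      ∃ e, supp (translate g₁ ρ) ∩ supp (translate g₂ ρ) = {e}
  pair : ∀ e ∈ outside a H, ∃ g₁ g₂ : Γ.π₁ a, g₁ ≠ g₂ ∧
    supp (translate g₁ ρ) ∩ supp (translate g₂ ρ) = {e} ∧
    ∀ h₁ h₂ : Γ.π₁ a, h₁ ≠ h₂ → supp (translate h₁ ρ) ∩ supp (translate h₂ ρ) = {e} →
      (h₁ = g₁ ∧ h₂ = g₂) ∨ (h₁ = g₂ ∧ h₂ = g₁)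
  noncommuting : ∃ g₁ g₂ : Γ.π₁ a, g₁ * g₂ ≠ g₂ * g₁ ∧
    (supp ρ ∩ supp (translate g₁ ρ)).Nonempty ∧ (supp ρ ∩ supp (translate g₂ ρ)).Nonempty

/-- Nielsen 1-chains. -/
def IsNielsen (f : Γ.SelfMap) (ha : f.onV a = a) (H : Γ.Subgraph) (ρ : Γ.Chain₁ a) : Prop :=
  IsFixedSegment f ha H ρ ∧ (IsNonGeometric H ρ ∨ IsGeometric H ρ)

/-- `ρ` generates `U` as a module over the rational group algebra of the fundamental group:
`ρ ∈ U` and every element of `U` is of the form `q₁ g₁ ρ + ⋯ + q_r g_r ρ`. -/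
def Generates (ρ : Γ.Chain₁ a) (U : Submodule ℚ (Γ.Chain₁ a)) : Prop :=
  ρ ∈ U ∧ ∀ x ∈ U, ∃ q : Γ.π₁ a →₀ ℚ, x = q.sum fun g c => c • translate g ρ

/-- `U` is a quasi-fixed submodule: a submodule of the relative 1-chains over the rational group
algebra of the fundamental group which is zero or generated by a Nielsen 1-chain. -/
structure IsQuasiFixed (f : Γ.SelfMap) (ha : f.onV a = a) (H : Γ.Subgraph)
    (U : Submodule ℚ (Γ.Chain₁ a)) : Prop where
  le_rel : U ≤ relChains a H
  translate_mem : ∀ (g : Γ.π₁ a), ∀ x ∈ U, translate g x ∈ U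
  generated : U ≠ ⊥ → ∃ ρ, IsNielsen f ha H ρ ∧ Generates ρ U

end CellGraph

/-! ### The Hilbert modules `L²(G)ⁿ` -/

/-- `L²(G)`: square summable functions `G → ℂ`. -/
abbrev L2 (G : Type*) : Type _ := lp (fun _ : G => ℂ) 2

/-- The Hilbert space `L²(G)ⁿ`. -/
abbrev L2n (G : Type*) (n : ℕ) : Type _ := PiLp 2 fun _ : Fin n => L2 G

namespace L2

theorem summable_sq {G : Type*} (ξ : L2 G) : Summable fun x => ‖ξ x‖ ^ (2 : ENNReal).toReal :=
  (memℓp_gen_iff (by norm_num)).1 ξ.2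

/-- The left action of `G` on `L²(G)`: `(h ξ)_g = ξ_{h⁻¹ g}`. -/
def act {G : Type*} [Group G] (h : G) : L2 G →ₗ[ℂ] L2 G where
  toFun ξ := ⟨fun g => ξ (h⁻¹ * g), (memℓp_gen_iff (by norm_num)).2
    ((summable_sq ξ).comp_injective (mul_right_injective h⁻¹))⟩
  map_add' _ _ := rfl
  map_smul' _ _ := rfl

/-- Extension by zero `L²(F) → L²(G)` along an injective homomorphism `F → G`. -/
noncomputable def ext {F G : Type*} [Group F] [Group G] (ι : F →* G)
    (hι : Function.Injective ι) : L2 F →ₗ[ℂ] L2 G where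
  toFun ξ := ⟨Function.extend ι (fun g => ξ g) 0, (memℓp_gen_iff (by norm_num)).2 (by
    refine (hι.summable_iff fun x hx => ?_).1 ?_
    · rw [Function.extend_apply' _ _ _ (by simpa using hx)]
      simp
    · simpa [Function.comp_def, hι.extend_apply] using summable_sq ξ)⟩
  map_add' ξ η := by
    refine Subtype.ext (funext fun x => ?_)
    change Function.extend ι (fun g => ξ g + η g) 0 x =
      Function.extend ι (fun g => ξ g) 0 x + Function.extend ι (fun g => η g) 0 x
    by_cases hx : ∃ g, ι g = x
    · obtain ⟨g, rfl⟩ := hx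
      simp [hι.extend_apply]
    · simp [Function.extend_apply' _ _ _ hx]
  map_smul' c ξ := by
    refine Subtype.ext (funext fun x => ?_)
    change Function.extend ι (fun g => c * ξ g) 0 x = c * Function.extend ι (fun g => ξ g) 0 x
    by_cases hx : ∃ g, ι g = x
    · obtain ⟨g, rfl⟩ := hx
      simp [hι.extend_apply]
    · simp [Function.extend_apply' _ _ _ hx]

end L2

namespace L2n

/-- A linear map applied to each coordinate. -/
noncomputable def mapCoord {F G : Type*} {n : ℕ} (T : L2 F →ₗ[ℂ] L2 G) : L2n F n →ₗ[ℂ] L2n G n where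
  toFun ξ := WithLp.toLp 2 fun i => T (ξ i)
  map_add' ξ η := by ext i : 1; simp
  map_smul' c ξ := by ext i : 1; simp

/-- The left action of `G` on `L²(G)ⁿ`. -/
noncomputable def act {G : Type*} [Group G] {n : ℕ} (h : G) : L2n G n →ₗ[ℂ] L2n G n := mapCoord (L2.act h)

end L2n

/-! ### The free-by-cyclic group -/

/-- The semidirect product `F ⋊_Φ ⟨t⟩` with `t⁻¹ x t = Φ x` for `x ∈ F`. (In Mathlib's semidirect
product the cyclic factor acts by `t x t⁻¹`, which is `Φ⁻¹ x`.) -/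
abbrev FreeByCyclic {F : Type*} [Group F] (Φ : MulAut F) : Type _ :=
  F ⋊[zpowersHom (MulAut F) Φ⁻¹] Multiplicative ℤ

/-- The stable letter `t`. -/
def FreeByCyclic.t {F : Type*} [Group F] (Φ : MulAut F) : FreeByCyclic Φ :=
  SemidirectProduct.inr (Multiplicative.ofAdd 1)

theorem FreeByCyclic.t_inv_mul_mul_t {F : Type*} [Group F] (Φ : MulAut F) (x : F) :
    (FreeByCyclic.t Φ)⁻¹ * SemidirectProduct.inl x * FreeByCyclic.t Φ =
      SemidirectProduct.inl (Φ x) := by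
  have h := SemidirectProduct.inl_aut (φ := zpowersHom (MulAut F) Φ⁻¹)
    (Multiplicative.ofAdd (-1 : ℤ)) x
  simp only [zpowersHom_apply, toAdd_ofAdd, zpow_neg, zpow_one, inv_inv] at h
  rw [h, FreeByCyclic.t]
  simp [ofAdd_neg]

/-! ### The modules `V_qf^{(2)}` and `W_qf^{(2)}` -/

namespace CellGraph

variable {V E : Type*} {Γ : CellGraph V E}

/-- A basis of the relative 1-chains over the group algebra that consists of `n` edges of the
universal cover, one above each edge of `Γ` outside `H`. -/
structure EdgeBasis (Γ : CellGraph V E) (a : V) (H : Γ.Subgraph) (n : ℕ) where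
  edge : Fin n → Γ.CoverEdge a
  bijOn : Set.BijOn (fun i => (edge i).proj) Set.univ H.edgesᶜ

variable {a : V} {H : Γ.Subgraph} {n : ℕ}

/-- The coordinates in `L²(F)ⁿ` of a 1-chain with respect to a basis of edges `b₁, …, bₙ`: the
`i`-th coordinate of `x` is `∑ g, x_{g b_i} g`. -/
noncomputable def EdgeBasis.coord (b : EdgeBasis Γ a H n) (x : Γ.Chain₁ a) :
    L2n (Γ.π₁ a) n :=
  WithLp.toLp 2 fun i => ⟨fun g => ((x (g • b.edge i) : ℚ) : ℂ),
    (memℓp_gen_iff (by norm_num)).2 (summable_of_hasFiniteSupport (by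
      refine ((x.support.finite_toSet.preimage
        (CoverEdge.smul_left_injective (b.edge i)).injOn)).subset fun g hg => ?_
      simp only [Set.mem_preimage, Finset.mem_coe, Finsupp.mem_support_iff]
      intro h0
      exact hg (by simp [h0])))⟩

/-- The Hilbert module `U^{(2)}` of a submodule `U` of relative 1-chains: the closure in `L²(F)ⁿ`
of the complex span of `U`. -/
noncomputable def hilbert (b : EdgeBasis Γ a H n) (U : Submodule ℚ (Γ.Chain₁ a)) :
    Submodule ℂ (L2n (Γ.π₁ a) n) :=
  (Submodule.span ℂ (b.coord '' U)).topologicalClosure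

end CellGraph

/-- For a subspace `U` of `L²(F)ⁿ`, the induced subspace `ι_* U`: the closure in `L²(F ⋊_Φ ⟨t⟩)ⁿ`
of the sum over `ℓ ∈ ℤ` of the (mutually orthogonal) subspaces `t^ℓ U`. -/
noncomputable def inducedModule {F : Type*} [Group F] (Φ : MulAut F) {n : ℕ}
    (U : Submodule ℂ (L2n F n)) : Submodule ℂ (L2n (FreeByCyclic Φ) n) :=
  (⨆ ℓ : ℤ, (U.map (L2n.mapCoord
      (L2.ext (SemidirectProduct.inl : F →* FreeByCyclic Φ)
        SemidirectProduct.inl_injective))).map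
    (L2n.act (FreeByCyclic.t Φ ^ ℓ))).topologicalClosure

/-! Let `R` be right convolution with the coordinates of the Nielsen chain `ρ`. It commutes with the
left action and sends the point mass at `g` to `gρ`, so its range is dense in the Hilbert module
generated by `ρ`. Everything reduces to a lower bound `‖ξ‖² ≤ C ‖Rξ‖²`: it makes `R` injective with
closed range, hence an isomorphism onto the module. The bound is proved over any group `G`
containing `𝔽`, and is used for `𝔽` and for `G_φ`; over `G_φ` the operator restricts to the one over
`𝔽` on every `t^ℓ L²(𝔽)`, so its range is the induced module (`IsNielsen.exists_norm_sq_le`,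
`L2.exists_equiv`, `L2n.convolve_ext`).

If `ρ` is non-geometric, one coordinate of `Rξ` is `±` a right translate of `ξ`, and `C = 1` works.
If `ρ` is geometric and shares an edge with `sρ`, that edge lies in no third translate. Since `ρ`
comes from a segment in a tree, its coefficients are `0` or `±1`, so after a shift some coordinate
of `Rξ` is `±ξ(x) ± ξ(xs)`. Passing to `|ξ|` removes the signs: `|ξ|` is moved by right translation
by `s` at most by `‖Rξ‖`. This holds for two non-commuting `s`. The elements that move `|ξ|` by at
most a constant times `‖Rξ‖` form a subgroup of a free group, which is therefore free and
non-abelian. Its right action on `G` is paradoxical, so a function almost invariant under it is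
small, which bounds `‖ξ‖` (`exists_tsum_sq_le`). -/

/-! ### A spectral gap for free subgroups -/

/-- For the set `B` of reduced words that begin with `x` or `x⁻¹`, one of `z`, `x⁻¹ z` lies in `B`,
and if `z` lies in `B`, then `y z` and `y² z` do not. -/
theorem FreeGroup.exists_paradoxical_set {X : Type*} {x y : X} (hxy : x ≠ y) :
    ∃ B : Set (FreeGroup X), (∀ z, z ∈ B ∨ (of x)⁻¹ * z ∈ B) ∧
      ∀ z ∈ B, of y * z ∉ B ∧ of y * (of y * z) ∉ B := by
  classical
  have key : ∀ z : FreeGroup X, ∀ v w, z ∈ startsWith v → z ∈ startsWith w → v = w := by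
    intro z v w hv hw
    simpa using hv.symm.trans hw
  refine ⟨startsWith (x, true) ∪ startsWith (x, false), fun z => ?_, fun z hz => ?_⟩
  · by_cases hz : z ∈ startsWith (x, true)
    · exact Or.inl (Or.inl hz)
    · exact Or.inr (Or.inr (startsWith_mk_mul (w := (x, false)) z hz))
  · have h1 : of y * z ∈ startsWith (y, true) := by
      refine startsWith_mk_mul (w := (y, true)) z fun h => hxy ?_
      rcases hz with hz | hz <;> exact congrArg Prod.fst (key z _ _ hz h)
    have h2 : of y * (of y * z) ∈ startsWith (y, true) := by
      refine startsWith_mk_mul (w := (y, true)) _ fun h => ?_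
      simpa using key _ _ _ h1 h
    constructor <;> rintro (h | h)
    · exact hxy (congrArg Prod.fst (key _ _ _ h h1))
    · exact hxy (congrArg Prod.fst (key _ _ _ h h1))
    · exact hxy (congrArg Prod.fst (key _ _ _ h h2))
    · exact hxy (congrArg Prod.fst (key _ _ _ h h2))

/-- A noncommutative free group has two distinct generators. -/
theorem IsFreeGroup.exists_generators_ne {M : Type*} [Group M] [IsFreeGroup M]
    (hM : ∃ g h : M, g * h ≠ h * g) : ∃ x y : IsFreeGroup.Generators M, x ≠ y := by
  by_contra! hsub
  obtain ⟨g, h, hgh⟩ := hM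
  apply hgh
  have : Subsingleton (IsFreeGroup.Generators M) := ⟨hsub⟩
  apply (IsFreeGroup.toFreeGroup M).injective
  rw [map_mul, map_mul]
  generalize IsFreeGroup.toFreeGroup M g = g'
  generalize IsFreeGroup.toFreeGroup M h = h'
  rcases isEmpty_or_nonempty (IsFreeGroup.Generators M) with hE | ⟨⟨c⟩⟩
  · exact Subsingleton.elim _ _
  · have : Unique (IsFreeGroup.Generators M) := ⟨⟨c⟩, fun _ => Subsingleton.elim _ _⟩
    apply FreeGroup.mulEquivIntOfUnique.injective
    rw [map_mul, map_mul, mul_comm]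

/-- The right action of a noncommutative free group on a group that contains it is paradoxical. -/
theorem exists_paradoxical_set {M G : Type*} [Group M] [IsFreeGroup M] [Group G]
    (hM : ∃ g h : M, g * h ≠ h * g) {j : M →* G} (hj : Function.Injective j) :
    ∃ (x y : M) (A : Set G), (∀ g, g ∈ A ∨ g * j x ∈ A) ∧
      ∀ g ∈ A, g * j y ∉ A ∧ g * j (y * y) ∉ A := by
  obtain ⟨x, y, hxy⟩ := IsFreeGroup.exists_generators_ne hM
  obtain ⟨B, hB1, hB2⟩ := FreeGroup.exists_paradoxical_set hxy
  -- Each left coset of `j(M)` is identified with `M` through a representative `c g`; `m g` is the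
  -- resulting coordinate.
  let c : G → G := fun g => (QuotientGroup.mk g : G ⧸ j.range).out
  have hc : ∀ g m, c (g * j m) = c g := fun g m => by
    have : (QuotientGroup.mk (g * j m) : G ⧸ j.range) = QuotientGroup.mk g := by
      rw [QuotientGroup.eq]; simp
    simp only [c, this]
  have hm : ∀ g, ∃ m, j m = (c g)⁻¹ * g := fun g =>
    QuotientGroup.eq.1 (QuotientGroup.out_eq' (QuotientGroup.mk g : G ⧸ j.range))
  choose m hm using hm
  have hmm : ∀ g k, m (g * j k) = m g * k := fun g k => hj (by
    rw [hm, hc, map_mul, hm, mul_assoc])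
  let φ := IsFreeGroup.toFreeGroup M
  have hφ : ∀ x, φ (IsFreeGroup.of x) = FreeGroup.of x := fun x => by
    simp [φ, IsFreeGroup.of]
  -- `B` is adapted to left multiplication; inverting the coordinate turns it into right
  -- multiplication, which is why the second element is the inverse of a generator.
  refine ⟨IsFreeGroup.of x, (IsFreeGroup.of y)⁻¹, {g | φ (m g)⁻¹ ∈ B}, fun g => ?_,
    fun g hg => ?_⟩
  · simpa [hmm, hφ] using hB1 (φ (m g)⁻¹)
  · simp only [Set.mem_ofPred_eq, hmm]
    simpa [hφ, mul_assoc] using hB2 _ hg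

theorem Summable.mul_right_translate {G : Type*} [Group G] {w : G → ℝ} (hw : Summable w) (g : G) :
    Summable fun x => w (x * g) :=
  hw.comp_injective (mul_left_injective g)

theorem tsum_mul_right_translate {G : Type*} [Group G] (w : G → ℝ) (g : G) :
    ∑' x, w (x * g) = ∑' x, w x :=
  (Equiv.mulRight g).tsum_eq w

theorem summable_sq_translate_sub {G : Type*} [Group G] {u : G → ℝ}
    (hu : Summable fun x => u x ^ 2) (g : G) : Summable fun x => (u (x * g) - u x) ^ 2 :=
  Summable.of_nonneg_of_le (fun _ => sq_nonneg _)
    (fun x => by nlinarith [sq_nonneg (u (x * g) + u x)])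
    (((hu.mul_right_translate g).mul_left 2).add (hu.mul_left 2))

/-- Two translates of `A` cover `G`, while three are disjoint. Let `S` be the total mass of `u²` and
`m` its mass on `A`. Up to translation errors the covering gives `S ≤ 2m` and the disjointness gives
`3m ≤ S`, which is impossible unless `S` is controlled by the errors. The constants come from `α² ≤
1.1 β² + 11 (α - β)²`: then `S ≤ 2.1 m + …` and `3m ≤ 1.1 S + …`, so `S ≤ 0.77 S + …`, and `100`
exceeds `11 / 0.23`. -/
theorem tsum_sq_le_of_paradoxical {G : Type*} [Group G] {A : Set G} {p q r : G}
    (h1 : ∀ g, g ∈ A ∨ g * p ∈ A) (h2 : ∀ g ∈ A, g * q ∉ A ∧ g * r ∉ A)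
    (h3 : ∀ g, g * q ∈ A → g * r ∉ A) {u : G → ℝ} (hu : Summable fun x => u x ^ 2) :
    ∑' x, u x ^ 2 ≤ 100 * ((∑' x, (u (x * p) - u x) ^ 2) + (∑' x, (u (x * q) - u x) ^ 2) +
      ∑' x, (u (x * r) - u x) ^ 2) := by
  classical
  have hdiff := summable_sq_translate_sub hu
  let w : G → ℝ := fun x => if x ∈ A then u x ^ 2 else 0
  have hw : Summable w := Summable.of_nonneg_of_le
    (fun x => by dsimp only [w]; split_ifs <;> positivity)
    (fun x => by dsimp only [w]; split_ifs <;> [rfl; positivity]) hu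
  have hws := hw.mul_right_translate
  have hwt := tsum_mul_right_translate w
  have i1 : ∑' x, u x ^ 2 ≤ ∑' x, (w x + 1.1 * w (x * p) + 11 * (u (x * p) - u x) ^ 2) := by
    refine Summable.tsum_le_tsum (fun x => ?_) hu
      ((hw.add ((hws p).mul_left _)).add ((hdiff p).mul_left _))
    have := sq_nonneg (u (x * p))
    rcases h1 x with hx | hx
    · simp only [w, if_pos hx]
      split_ifs <;> nlinarith [sq_nonneg (u (x * p) - u x)]
    · simp only [w, if_pos hx]
      split_ifs <;> nlinarith [sq_nonneg (u (x * p) - u x),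
        sq_nonneg (u (x * p) + 10 * (u (x * p) - u x))]
  rw [Summable.tsum_add (hw.add ((hws p).mul_left _)) ((hdiff p).mul_left _),
    Summable.tsum_add hw ((hws p).mul_left _), tsum_mul_left, tsum_mul_left, hwt] at i1
  have i2 : ∑' x, (w x + w (x * q) + w (x * r)) ≤
      ∑' x, (1.1 * u x ^ 2 + 11 * (u (x * q) - u x) ^ 2 + 11 * (u (x * r) - u x) ^ 2) := by
    refine Summable.tsum_le_tsum (fun x => ?_) ((hw.add (hws q)).add (hws r))
      (((hu.mul_left _).add ((hdiff q).mul_left _)).add ((hdiff r).mul_left _))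
    have e1 := sq_nonneg (u (x * q) - u x)
    have e2 := sq_nonneg (u (x * r) - u x)
    have e0 := sq_nonneg (u x)
    by_cases hx : x ∈ A
    · simp only [w, if_pos hx, if_neg (h2 x hx).1, if_neg (h2 x hx).2]
      nlinarith
    · by_cases hq : x * q ∈ A
      · simp only [w, if_neg hx, if_pos hq, if_neg (h3 x hq)]
        nlinarith [sq_nonneg (u x - 10 * (u (x * q) - u x))]
      · simp only [w, if_neg hx, if_neg hq]
        split_ifs <;> nlinarith [sq_nonneg (u x - 10 * (u (x * r) - u x))]
  rw [Summable.tsum_add (hw.add (hws q)) (hws r), Summable.tsum_add hw (hws q), hwt, hwt,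
    Summable.tsum_add ((hu.mul_left _).add ((hdiff q).mul_left _)) ((hdiff r).mul_left _),
    Summable.tsum_add (hu.mul_left _) ((hdiff q).mul_left _), tsum_mul_left, tsum_mul_left,
    tsum_mul_left] at i2
  have n1 : 0 ≤ ∑' x, (u (x * p) - u x) ^ 2 := tsum_nonneg fun _ => sq_nonneg _
  have n2 : 0 ≤ ∑' x, (u (x * q) - u x) ^ 2 := tsum_nonneg fun _ => sq_nonneg _
  have n3 : 0 ≤ ∑' x, (u (x * r) - u x) ^ 2 := tsum_nonneg fun _ => sq_nonneg _
  linarith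

/-- Right translates of a square summable function by elements of a noncommutative free group are
uniformly far from it. The functions `u` range over any family `U`, and `Q` is any functional
that controls the translations by two noncommuting elements of the free group. -/
theorem exists_tsum_sq_le {F G ι : Type*} [Group F] [IsFreeGroup F] [Group G] {j : F →* G}
    (hj : Function.Injective j) (u : ι → G → ℝ) (hu : ∀ i, Summable fun x => u i x ^ 2)
    (Q : ι → ℝ) {s₁ s₂ : F} (hs : s₁ * s₂ ≠ s₂ * s₁)
    (h₁ : ∀ i, ∑' x, (u i (x * j s₁) - u i x) ^ 2 ≤ Q i)
    (h₂ : ∀ i, ∑' x, (u i (x * j s₂) - u i x) ^ 2 ≤ Q i) :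
    ∃ C : ℝ, ∀ i, ∑' x, u i x ^ 2 ≤ C * Q i := by
  have hdiff := fun i => summable_sq_translate_sub (hu i)
  -- Taking all elements with some constant, and not only the subgroup generated by `s₁` and `s₂`,
  -- provides the constants for the paradoxical elements without expanding words. `N` is free by
  -- Nielsen–Schreier.
  let N : Subgroup F :=
    { carrier := {s | ∃ C : ℝ, ∀ i, ∑' x, (u i (x * j s) - u i x) ^ 2 ≤ C * Q i}
      one_mem' := ⟨0, fun i => by simp⟩
      mul_mem' := by
        rintro a b ⟨C, hC⟩ ⟨D, hD⟩
        refine ⟨2 * C + 2 * D, fun i => ?_⟩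
        have hb : Summable fun x => (u i (x * j a * j b) - u i (x * j a)) ^ 2 :=
          (hdiff i (j b)).mul_right_translate (j a)
        have hb' : ∑' x, (u i (x * j a * j b) - u i (x * j a)) ^ 2 =
            ∑' x, (u i (x * j b) - u i x) ^ 2 :=
          tsum_mul_right_translate (fun x => (u i (x * j b) - u i x) ^ 2) (j a)
        calc ∑' x, (u i (x * j (a * b)) - u i x) ^ 2
            ≤ ∑' x, (2 * (u i (x * j a) - u i x) ^ 2 +
                2 * (u i (x * j a * j b) - u i (x * j a)) ^ 2) := by
              refine Summable.tsum_le_tsum (fun x => ?_) (hdiff i _)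
                (((hdiff i _).mul_left _).add (hb.mul_left _))
              rw [map_mul, ← mul_assoc]
              nlinarith [sq_nonneg (u i (x * j a) - u i x -
                (u i (x * j a * j b) - u i (x * j a)))]
          _ = 2 * ∑' x, (u i (x * j a) - u i x) ^ 2 +
                2 * ∑' x, (u i (x * j b) - u i x) ^ 2 := by
              rw [Summable.tsum_add ((hdiff i _).mul_left _) (hb.mul_left _), tsum_mul_left,
                tsum_mul_left, hb']
          _ ≤ _ := by linarith [hC i, hD i]
      inv_mem' := by
        rintro a ⟨C, hC⟩
        refine ⟨C, fun i => le_trans (le_of_eq ?_) (hC i)⟩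
        rw [← tsum_mul_right_translate _ (j a)]
        refine tsum_congr fun x => ?_
        simp only [map_inv, mul_inv_cancel_right]
        ring }
  have hN1 : s₁ ∈ N := ⟨1, fun i => by simpa using h₁ i⟩
  have hN2 : s₂ ∈ N := ⟨1, fun i => by simpa using h₂ i⟩
  have hN : ∃ g h : N, g * h ≠ h * g :=
    ⟨⟨s₁, hN1⟩, ⟨s₂, hN2⟩, fun h => hs (congrArg Subtype.val h)⟩
  obtain ⟨x, y, A, hA1, hA2⟩ := exists_paradoxical_set hN (j := j.comp N.subtype)
    (hj.comp N.subtype_injective)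
  obtain ⟨Cx, hCx⟩ := x.2
  obtain ⟨Cy, hCy⟩ := y.2
  obtain ⟨Cz, hCz⟩ := (y * y).2
  refine ⟨100 * (Cx + Cy + Cz), fun i => ?_⟩
  -- The third disjointness, of the translates for `y` and `y * y`, is the first one applied at `g *
  -- j y`.
  have := tsum_sq_le_of_paradoxical hA1 hA2 (fun g hg => by
    have := (hA2 _ hg).1
    rwa [mul_assoc, ← map_mul] at this) (hu i)
  simp only [MonoidHom.comp_apply, Subgroup.coe_subtype] at this
  linarith [hCx i, hCy i, hCz i]

/-! ### Segments in the universal cover -/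

/-- Multiplication by a generator `d` on the right changes the first letter of a reduced word to
or from `c` only if the word is empty and `c = d`. -/
theorem FreeGroup.mul_of_mem_startsWith_iff {X : Type*} [DecidableEq X] {y : FreeGroup X} {c d : X}
    (h : ¬ (y = 1 ∧ c = d)) :
    y * of d ∈ startsWith (c, true) ↔ y ∈ startsWith (c, true) := by
  have hr : IsReduced y.toWord := isReduced_toWord
  by_cases hL : ∃ L, y.toWord = L ++ [(d, false)]
  · obtain ⟨L, hL⟩ := hL
    rw [hL] at hr
    have hy : y * of d = mk L := by
      rw [← mk_toWord (x := y), hL, of, mul_mk]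
      exact Quot.sound (by simpa using Red.Step.not (L₁ := L) (L₂ := []) (x := d) (b := false))
    have hw : (y * of d).toWord = L := by
      rw [hy, toWord_mk]
      exact IsReduced.reduce_eq (hr.infix (List.prefix_append _ _).isInfix)
    simp only [startsWith, Set.mem_ofPred_eq, hw, hL]
    -- If `L` is empty, then `y` is the inverse of `d`: neither `y` nor the empty word starts with a
    -- positive letter.
    cases L <;> simp
  · have hw : (y * of d).toWord = y.toWord ++ [(d, true)] := by
      rw [toWord_mul, toWord_of]
      apply IsReduced.reduce_eq
      refine List.isChain_append.2 ⟨hr, by simp, ?_⟩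
      rintro ⟨z, b⟩ hz w hw hzw
      simp only [List.head?_cons, Option.mem_def, Option.some.injEq] at hw
      subst hw
      obtain rfl : z = d := hzw
      by_contra hb
      obtain rfl : b = false := by simpa using hb
      exact hL ⟨_, (List.dropLast_append_getLast? _ hz).symm⟩
    simp only [startsWith, Set.mem_ofPred_eq, hw]
    rcases hy : y.toWord with _ | ⟨z, L⟩
    · have : y = 1 := toWord_eq_nil_iff.1 hy
      simp only [this, true_and] at h
      simp [Ne.symm h]
    · simp

open Classical in
theorem FreeGroup.indicator_startsWith_mul_of_sub {X : Type*} (y : FreeGroup X) (c d : X) :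
    (startsWith (c, true)).indicator (1 : FreeGroup X → ℚ) (y * of d) -
      (startsWith (c, true)).indicator 1 y = if y = 1 ∧ c = d then 1 else 0 := by
  split_ifs with h
  · obtain ⟨rfl, rfl⟩ := h
    simp [startsWith, Set.indicator]
  · simp [Set.indicator, mul_of_mem_startsWith_iff h]

namespace CellGraph

variable {V E : Type*} {Γ : CellGraph V E} {a : V} {H : Γ.Subgraph}

open Classical in
/-- The indicator function of the side of the edge `e` that contains its terminal vertex. -/
noncomputable def CoverEdge.side (e : Γ.CoverEdge a) (x : Γ.CoverVertex a) : ℚ :=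
  (FreeGroup.startsWith (e.1.1, true)).indicator 1 (e.1.2⁻¹ * x.1.2)

open Classical in
theorem CoverEdge.side_t_sub_side_o (e e' : Γ.CoverEdge a) :
    e.side e'.t - e.side e'.o = if e' = e then 1 else 0 := by
  have hiff : e' = e ↔ e.1.2⁻¹ * e'.1.2 = 1 ∧ e.1.1 = e'.1.1 :=
    ⟨fun h => by rw [h]; simp,
      fun h => Subtype.ext (Prod.ext h.2.symm (inv_mul_eq_one.1 h.1).symm)⟩
  refine Eq.trans ?_ (FreeGroup.indicator_startsWith_mul_of_sub (e.1.2⁻¹ * e'.1.2) e.1.1 e'.1.1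
    |>.trans (if_congr hiff.symm rfl rfl))
  rw [mul_assoc]
  rfl

/-- The function `e.side` changes only across `e`, so its coboundary is the functional reading off
the coefficient at `e`. Hence a chain is determined by its boundary. -/
theorem linearCombination_side_boundary (e : Γ.CoverEdge a) (c : Γ.Chain₁ a) :
    Finsupp.linearCombination ℚ e.side (boundary c) = c e := by
  classical
  have : Finsupp.linearCombination ℚ e.side ∘ₗ boundary = Finsupp.lapply e := by
    ext e'
    simp [boundary, CoverEdge.side_t_sub_side_o, Finsupp.single_apply]
  exact LinearMap.congr_fun this c

/-- The coefficients of a segment in a tree are `0`, `1` or `-1`. -/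
theorem IsFixedSegment.coeff {f : Γ.SelfMap} {ha : f.onV a = a} {ρ : Γ.Chain₁ a}
    (h : IsFixedSegment f ha H ρ) (e : Γ.CoverEdge a) : ρ e = 0 ∨ |ρ e| = 1 := by
  classical
  obtain ⟨u, v, c, -, -, hc, rfl⟩ := h
  rw [projRel, Finsupp.filter_apply]
  split_ifs
  -- The coefficient is the difference of the sides of `v` and `u`, each of which is `0` or `1`.
  · rw [← linearCombination_side_boundary, hc]
    simp only [map_sub, Finsupp.linearCombination_single, CoverEdge.side, Set.indicator]
    split_ifs <;> simp
  · exact Or.inl rfl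

theorem IsFixedSegment.mem_outside {f : Γ.SelfMap} {ha : f.onV a = a} {ρ : Γ.Chain₁ a}
    (h : IsFixedSegment f ha H ρ) {e : Γ.CoverEdge a} (he : ρ e ≠ 0) : e ∈ outside a H := by
  classical
  obtain ⟨u, v, c, -, -, hc, rfl⟩ := h
  by_contra hn
  exact he (Finsupp.filter_apply_neg _ _ hn)

theorem translate_apply (g : Γ.π₁ a) (x : Γ.Chain₁ a) (e : Γ.CoverEdge a) :
    translate g x e = x (g⁻¹ • e) := by
  conv_lhs => rw [← smul_inv_smul g e]
  exact Finsupp.mapDomain_apply (MulAction.injective g) x _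

/-- An edge that a geometric chain shares with its translate by `s` lies in no other translate. -/
theorem IsGeometric.exists_edge {ρ : Γ.Chain₁ a} (h : IsGeometric H ρ)
    (hout : ∀ e, ρ e ≠ 0 → e ∈ outside a H) {s : Γ.π₁ a} (hs : s ≠ 1)
    (hne : (supp ρ ∩ supp (translate s ρ)).Nonempty) :
    ∃ e ∈ outside a H, ρ e ≠ 0 ∧ ρ (s⁻¹ • e) ≠ 0 ∧
      ∀ k : Γ.π₁ a, k ≠ 1 → k ≠ s → ρ (k⁻¹ • e) = 0 := by
  have h1 : translate (1 : Γ.π₁ a) ρ = ρ := by ext e; simp [translate_apply]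
  obtain ⟨e, he1, hes⟩ := hne
  -- Any translate by `k ≠ 1` containing `e` meets `ρ` in exactly `{e}`. A further `k ≠ s` would
  -- make `{1, s}` and `{1, k}` two distinct pairs for the same edge.
  have key : ∀ k : Γ.π₁ a, k ≠ 1 → e ∈ supp (translate k ρ) →
      supp (translate 1 ρ) ∩ supp (translate k ρ) = {e} := by
    intro k hk hek
    have hmem : e ∈ supp (translate 1 ρ) ∩ supp (translate k ρ) := ⟨by rwa [h1], hek⟩
    rcases h.single 1 k hk.symm with h0 | ⟨e', he'⟩
    · rw [h0] at hmem; exact hmem.elim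
    · rw [he'] at hmem ⊢; rw [Set.mem_singleton_iff.1 hmem]
  refine ⟨e, hout e he1, he1, by simpa [supp, translate_apply] using hes, fun k hk1 hks => ?_⟩
  by_contra hk
  obtain ⟨g₁, g₂, -, -, hu⟩ := h.pair e (hout e he1)
  have hu1 := hu 1 s hs.symm (key s hs hes)
  have hu2 := hu 1 k hk1.symm (key k hk1 (by simpa [supp, translate_apply] using hk))
  rcases hu1 with ⟨a1, a2⟩ | ⟨a1, a2⟩ <;> rcases hu2 with ⟨b1, b2⟩ | ⟨b1, b2⟩
  · exact hks (b2.trans a2.symm)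
  · exact hs (a2.trans b1.symm)
  · exact hs (a2.trans b1.symm)
  · exact hks (b2.trans a2.symm)

/-- Every edge outside `H` is a translate of a basis edge. -/
theorem EdgeBasis.exists_smul {n : ℕ} (b : EdgeBasis Γ a H n) {e : Γ.CoverEdge a}
    (he : e ∈ outside a H) : ∃ (i : Fin n) (k : Γ.π₁ a), k • b.edge i = e := by
  obtain ⟨i, -, hi⟩ := b.bijOn.surjOn he
  have hi : (b.edge i).1.1 = e.1.1 := hi
  have hb : (b.edge i).1.2 ∈ Γ.PathClass a (Γ.o e.1.1) := by rw [← hi]; exact (b.edge i).2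
  refine ⟨i, ⟨e.1.2 * (b.edge i).1.2⁻¹, PathClass.mul_mem e.2 (PathClass.inv_mem hb)⟩, ?_⟩
  exact Subtype.ext (Prod.ext hi (inv_mul_cancel_right _ _))

end CellGraph

/-! ### Convolution operators -/

namespace L2

variable {G : Type*}

theorem summable_norm_sq (ξ : L2 G) : Summable fun x => ‖ξ x‖ ^ 2 := by
  simpa using summable_sq ξ

theorem norm_sq_eq (ξ : L2 G) : ‖ξ‖ ^ 2 = ∑' x, ‖ξ x‖ ^ 2 := by
  simpa using lp.norm_rpow_eq_tsum (p := 2) (by norm_num) ξ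

/-- Right translation: `(ξ g)_x = ξ_{x g⁻¹}`. -/
noncomputable def rightTranslate [Group G] (g : G) : L2 G →L[ℂ] L2 G :=
  LinearMap.mkContinuous
    { toFun := fun ξ => ⟨fun x => ξ (x * g⁻¹), (memℓp_gen_iff (by norm_num)).2
        ((summable_sq ξ).comp_injective (mul_left_injective g⁻¹))⟩
      map_add' := fun _ _ => rfl
      map_smul' := fun _ _ => rfl } 1 fun ξ => by
    rw [one_mul]
    refine le_of_eq ((sq_eq_sq₀ (norm_nonneg _) (norm_nonneg _)).1 ?_)
    rw [norm_sq_eq, norm_sq_eq]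
    exact tsum_mul_right_translate (fun x => ‖ξ x‖ ^ 2) g⁻¹

theorem act_apply [Group G] (g : G) (ξ : L2 G) (x : G) : act g ξ x = ξ (g⁻¹ * x) := rfl

theorem act_single [Group G] [DecidableEq G] (g h : G) (c : ℂ) :
    act g (lp.single 2 h c) = lp.single 2 (g * h) c := by
  ext x
  rw [act_apply]
  simp only [lp.single_apply, Pi.single_apply, inv_mul_eq_iff_eq_mul]

theorem ext_apply {F : Type*} [Group F] [Group G] {ι : F →* G} (hι : Function.Injective ι)
    (ξ : L2 F) (x : F) : ext ι hι ξ (ι x) = ξ x :=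
  hι.extend_apply _ _ _

theorem ext_apply_of_notMem {F : Type*} [Group F] [Group G] {ι : F →* G}
    (hι : Function.Injective ι) (ξ : L2 F) {x : G} (hx : x ∉ ι.range) : ext ι hι ξ x = 0 :=
  Function.extend_apply' _ _ _ hx

theorem ext_single {F : Type*} [Group F] [Group G] [DecidableEq F] [DecidableEq G] {ι : F →* G}
    (hι : Function.Injective ι) (g : F) (c : ℂ) :
    ext ι hι (lp.single 2 g c) = lp.single 2 (ι g) c := by
  ext x
  by_cases hx : x ∈ ι.range
  · obtain ⟨y, rfl⟩ := hx
    simp [ext_apply, lp.single_apply, Pi.single_apply, hι.eq_iff]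
  · rw [ext_apply_of_notMem hι _ hx, lp.single_apply, Pi.single_apply, if_neg]
    rintro rfl
    exact hx ⟨g, rfl⟩

theorem mem_of_single_mem [DecidableEq G] {P : Submodule ℂ (L2 G)}
    (hP : IsClosed (P : Set (L2 G))) (h : ∀ g, lp.single 2 g (1 : ℂ) ∈ P) (ξ : L2 G) : ξ ∈ P := by
  refine hP.mem_of_tendsto (lp.hasSum_single (by norm_num) ξ)
    (Filter.Eventually.of_forall fun s => P.sum_mem fun g _ => ?_)
  have : lp.single 2 g (ξ g) = ξ g • (lp.single 2 g (1 : ℂ) : L2 G) := by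
    rw [← lp.single_smul, smul_eq_mul, mul_one]
  rw [this]
  exact P.smul_mem _ (h g)

/-- A bounded below operator on `L²(G)` is an isomorphism onto any closed subspace that contains
the images of the point masses and is contained in the range. -/
theorem exists_equiv [DecidableEq G] {X : Type*} [NormedAddCommGroup X] [NormedSpace ℂ X]
    [CompleteSpace X] (R : L2 G →L[ℂ] X) {C : ℝ} (hC : ∀ ξ, ‖ξ‖ ^ 2 ≤ C * ‖R ξ‖ ^ 2)
    {P : Submodule ℂ X} (hP : IsClosed (P : Set X)) (h1 : ∀ g, R (lp.single 2 g 1) ∈ P)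
    (h2 : IsClosed (R.range : Set X) → P ≤ R.range) :
    ∃ O : L2 G ≃L[ℂ] P, ∀ ξ, (O ξ : X) = R ξ := by
  -- `C` is not assumed nonnegative, whence the absolute value.
  have hb : ∀ ξ, ‖ξ‖ ≤ (Real.sqrt |C|).toNNReal * ‖R ξ‖ := fun ξ => by
    rw [Real.coe_toNNReal _ (Real.sqrt_nonneg _)]
    refine abs_le_of_sq_le_sq' ?_ (by positivity) |>.2
    rw [mul_pow, Real.sq_sqrt (abs_nonneg _)]
    exact (hC ξ).trans (mul_le_mul_of_nonneg_right (le_abs_self C) (sq_nonneg _))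
  have hanti := AddMonoidHomClass.antilipschitz_of_bound R hb
  -- Closedness of the range is available only from here on; it is the premise of `h2`.
  have hclosed : IsClosed (Set.range R) := hanti.isClosed_range R.uniformContinuous
  have hle : R.range ≤ P := by
    rintro _ ⟨ξ, rfl⟩
    exact mem_of_single_mem (P := P.comap R.toLinearMap) (hP.preimage R.continuous) h1 ξ
  obtain rfl : R.range = P := le_antisymm hle (h2 hclosed)
  exact ⟨R.equivRange hanti.injective hclosed, fun ξ => rfl⟩

end L2

namespace L2n

variable {F G : Type*} [Group F] [Group G] {n : ℕ}

/-- Right convolution `L²(G) → L²(G)ⁿ` with an `n`-tuple of finitely supported functions on `F`,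
for a homomorphism `ι : F → G`. -/
noncomputable def convolve (ι : F →* G) (r : Fin n → F →₀ ℂ) : L2 G →L[ℂ] L2n G n :=
  (PiLp.continuousLinearEquiv 2 ℂ fun _ : Fin n => L2 G).symm.toContinuousLinearMap ∘L
    ContinuousLinearMap.pi fun i => (r i).sum fun k c => c • L2.rightTranslate (ι k)

theorem convolve_apply (ι : F →* G) (r : Fin n → F →₀ ℂ) (ξ : L2 G) (i : Fin n) (x : G) :
    convolve ι r ξ i x = (r i).sum fun k c => c * ξ (x * (ι k)⁻¹) := by
  change ((r i).sum fun k c => c • L2.rightTranslate (ι k)) ξ x = _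
  rw [Finsupp.sum, Finsupp.sum, sum_apply, lp.coeFn_sum, Finset.sum_apply]
  rfl

theorem act_apply (g : G) (η : L2n G n) (i : Fin n) (x : G) : act g η i x = η i (g⁻¹ * x) := rfl

theorem convolve_act (ι : F →* G) (r : Fin n → F →₀ ℂ) (g : G) (ξ : L2 G) :
    convolve ι r (L2.act g ξ) = act g (convolve ι r ξ) := by
  ext i x
  simp only [act_apply, convolve_apply, L2.act_apply, mul_assoc]

/-- Right translation by `ι k` preserves the left cosets of the image of `ι`, so nothing leaks out
of `L²(F)`. This compares the convolution operators over the two groups. -/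
theorem convolve_ext {ι : F →* G} (hι : Function.Injective ι) (r : Fin n → F →₀ ℂ) (ξ : L2 F) :
    convolve ι r (L2.ext ι hι ξ) =
      mapCoord (L2.ext ι hι) (convolve (MonoidHom.id F) r ξ) := by
  ext i x
  change _ = L2.ext ι hι (convolve (MonoidHom.id F) r ξ i) x
  rw [convolve_apply]
  by_cases hx : x ∈ ι.range
  · obtain ⟨y, rfl⟩ := hx
    rw [L2.ext_apply, convolve_apply]
    simp only [← map_inv, ← map_mul, L2.ext_apply]
    rfl
  · rw [L2.ext_apply_of_notMem hι _ hx]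
    refine Finset.sum_eq_zero fun k _ => ?_
    refine mul_eq_zero_of_right _ (L2.ext_apply_of_notMem hι _ ?_)
    rwa [Subgroup.mul_mem_cancel_right _ (inv_mem (MonoidHom.mem_range.2 ⟨k, rfl⟩))]

theorem tsum_coord_le {G : Type*} (η : L2n G n) (i : Fin n) : ∑' x, ‖η i x‖ ^ 2 ≤ ‖η‖ ^ 2 := by
  rw [← L2.norm_sq_eq]
  exact pow_le_pow_left₀ (norm_nonneg _) (PiLp.norm_apply_le η i) 2

/-- The `i`-th coordinate of the convolution is a unimodular multiple of a right translate of `ξ`.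
-/
theorem norm_sq_le_convolve_of_isolated (ι : F →* G) {r : Fin n → F →₀ ℂ} {i : Fin n} {k₀ : F}
    (h₀ : ‖r i k₀‖ = 1) (h : ∀ k, k ≠ k₀ → r i k = 0) (ξ : L2 G) :
    ‖ξ‖ ^ 2 ≤ ‖convolve ι r ξ‖ ^ 2 := by
  refine le_trans (le_of_eq ?_) (tsum_coord_le _ i)
  rw [L2.norm_sq_eq, ← tsum_mul_right_translate _ (ι k₀)⁻¹]
  refine tsum_congr fun x => ?_
  rw [convolve_apply, Finsupp.sum_of_support_subset (s := {k₀})]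
  · simp [h₀]
  · intro k hk
    by_contra hne
    exact Finsupp.mem_support_iff.1 hk (h k (by simpa using hne))
  · simp

/-- After a shift by `k₀`, the `i`-th coordinate is `α ξ(x) + β ξ(xs)` with `|α| = |β| = 1`; the
reverse triangle inequality removes `α` and `β`. -/
theorem tsum_translate_sub_le_convolve (ι : F →* G) {r : Fin n → F →₀ ℂ} {i : Fin n} {s k₀ : F}
    (hs : s ≠ 1) (h₀ : ‖r i k₀‖ = 1) (h₁ : ‖r i (s⁻¹ * k₀)‖ = 1)
    (h : ∀ k, k ≠ k₀ → k ≠ s⁻¹ * k₀ → r i k = 0) (ξ : L2 G) :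
    ∑' x, (‖ξ (x * ι s)‖ - ‖ξ x‖) ^ 2 ≤ ‖convolve ι r ξ‖ ^ 2 := by
  classical
  refine le_trans ?_ (tsum_coord_le _ i)
  rw [← tsum_mul_right_translate (fun x => ‖convolve ι r ξ i x‖ ^ 2) (ι k₀)]
  have hne : k₀ ≠ s⁻¹ * k₀ := fun h => hs (by simpa using h)
  refine Summable.tsum_le_tsum (fun x => ?_)
    (summable_sq_translate_sub (L2.summable_norm_sq ξ) _)
    ((L2.summable_norm_sq _).mul_right_translate _)
  rw [convolve_apply, Finsupp.sum_of_support_subset (s := {k₀, s⁻¹ * k₀})]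
  · rw [Finset.sum_pair hne, sq_le_sq, abs_norm]
    have e1 : x * ι k₀ * (ι (s⁻¹ * k₀))⁻¹ = x * ι s := by simp [mul_assoc]
    have e2 : x * ι k₀ * (ι k₀)⁻¹ = x := by simp
    rw [e1, e2]
    have n1 : ‖ξ (x * ι s)‖ = ‖r i (s⁻¹ * k₀) * ξ (x * ι s)‖ := by rw [norm_mul, h₁, one_mul]
    have n2 : ‖ξ x‖ = ‖-(r i k₀ * ξ x)‖ := by rw [norm_neg, norm_mul, h₀, one_mul]
    rw [n1, n2, add_comm, ← sub_neg_eq_add]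
    exact abs_norm_sub_norm_le _ _
  · intro k hk
    by_contra hne
    simp only [Finset.mem_insert, Finset.mem_singleton, not_or] at hne
    exact Finsupp.mem_support_iff.1 hk (h k hne.1 hne.2)
  · simp

end L2n

/-! ### Quasi-fixed submodules -/

namespace CellGraph

variable {V E : Type*} {Γ : CellGraph V E} {a : V} {H : Γ.Subgraph} {n : ℕ}

/-- The coordinates of a 1-chain with respect to a basis of edges, as finitely supported
functions. -/
noncomputable def EdgeBasis.coeffs (b : EdgeBasis Γ a H n) (x : Γ.Chain₁ a) (i : Fin n) :
    Γ.π₁ a →₀ ℂ :=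
  (x.comapDomain (fun g : Γ.π₁ a => g • b.edge i)
    (CoverEdge.smul_left_injective (b.edge i)).injOn).mapRange (fun q : ℚ => (q : ℂ)) Rat.cast_zero

theorem EdgeBasis.coeffs_apply (b : EdgeBasis Γ a H n) (x : Γ.Chain₁ a) (i : Fin n)
    (g : Γ.π₁ a) : b.coeffs x i g = ((x (g • b.edge i) : ℚ) : ℂ) := rfl

theorem EdgeBasis.coord_apply (b : EdgeBasis Γ a H n) (x : Γ.Chain₁ a) (i : Fin n)
    (g : Γ.π₁ a) : b.coord x i g = ((x (g • b.edge i) : ℚ) : ℂ) := rfl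

theorem EdgeBasis.coord_zero (b : EdgeBasis Γ a H n) : b.coord 0 = 0 := by
  ext i g
  simp [b.coord_apply]

theorem EdgeBasis.coord_add (b : EdgeBasis Γ a H n) (x y : Γ.Chain₁ a) :
    b.coord (x + y) = b.coord x + b.coord y := by
  ext i g
  simp [b.coord_apply]

theorem EdgeBasis.coord_smul (b : EdgeBasis Γ a H n) (c : ℚ) (x : Γ.Chain₁ a) :
    b.coord (c • x) = (c : ℂ) • b.coord x := by
  ext i g
  simp [b.coord_apply]

/-- Only `k = g⁻¹ * x` contributes at `x`. This identifies the convolution as the continuous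
extension of `q ↦ qρ`. -/
theorem EdgeBasis.convolve_single [DecidableEq (Γ.π₁ a)] (b : EdgeBasis Γ a H n)
    (ρ : Γ.Chain₁ a) (g : Γ.π₁ a) :
    L2n.convolve (MonoidHom.id _) (b.coeffs ρ) (lp.single 2 g 1) = b.coord (translate g ρ) := by
  ext i x
  rw [L2n.convolve_apply, b.coord_apply, translate_apply, smul_smul, ← b.coeffs_apply,
    Finsupp.sum_of_support_subset (s := insert (g⁻¹ * x) (b.coeffs ρ i).support) _
      (Finset.subset_insert _ _) _ (by simp), Finset.sum_eq_single (g⁻¹ * x)]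
  · simp
  · intro k _ hk
    rw [lp.single_apply, Pi.single_apply, if_neg, mul_zero]
    rintro h
    apply hk
    rw [← h]
    simp
  · simp

/-- Convolution with the coordinates of a Nielsen 1-chain is bounded below. -/
theorem IsNielsen.exists_norm_sq_le {f : Γ.SelfMap} {ha : f.onV a = a} {ρ : Γ.Chain₁ a}
    (hρ : IsNielsen f ha H ρ) (b : EdgeBasis Γ a H n) {G : Type*} [Group G] {ι : Γ.π₁ a →* G}
    (hι : Function.Injective ι) :
    ∃ C : ℝ, ∀ ξ, ‖ξ‖ ^ 2 ≤ C * ‖L2n.convolve ι (b.coeffs ρ) ξ‖ ^ 2 := by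
  obtain ⟨hseg, hng | hgeo⟩ := hρ
  · obtain ⟨e, he, h1, h0⟩ := hng
    obtain ⟨i, k, rfl⟩ := b.exists_smul he
    refine ⟨1, fun ξ => ?_⟩
    rw [one_mul]
    refine L2n.norm_sq_le_convolve_of_isolated ι (i := i) (k₀ := k) ?_ (fun m hm => ?_) ξ
    · rw [b.coeffs_apply]
      rcases h1 with h1 | h1 <;> simp [h1]
    · rw [b.coeffs_apply]
      have := h0 (m * k⁻¹) (fun h => hm (mul_inv_eq_one.1 h))
      rw [smul_smul, inv_mul_cancel_right] at this
      simp [this]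
  · have hnorm : ∀ e, ρ e ≠ 0 → ‖((ρ e : ℚ) : ℂ)‖ = 1 := fun e he => by
      have h := (hseg.coeff e).resolve_left he
      rw [Complex.norm_ratCast, ← Rat.cast_abs, h, Rat.cast_one]
    obtain ⟨s₁, s₂, hs, hm₁, hm₂⟩ := hgeo.noncommuting
    -- Write the shared edge as `k • b.edge i`. As no other translate contains it, the `i`-th
    -- coordinate of `ρ` is supported on `k` and `s⁻¹ * k`.
    have key : ∀ s : Γ.π₁ a, s ≠ 1 → (supp ρ ∩ supp (translate s ρ)).Nonempty → ∀ ξ : L2 G,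
        ∑' x, (‖ξ (x * ι s)‖ - ‖ξ x‖) ^ 2 ≤ ‖L2n.convolve ι (b.coeffs ρ) ξ‖ ^ 2 := by
      intro s hs1 hm
      obtain ⟨e, he, h1, h2, h0⟩ := hgeo.exists_edge (fun e => hseg.mem_outside) hs1 hm
      obtain ⟨i, k, rfl⟩ := b.exists_smul he
      refine L2n.tsum_translate_sub_le_convolve ι (i := i) (k₀ := k) hs1 (hnorm _ h1) ?_
        fun m hmk hms => ?_
      · rw [b.coeffs_apply, ← smul_smul]
        exact hnorm _ h2
      · rw [b.coeffs_apply]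
        have := h0 (k * m⁻¹) (fun h => hmk (mul_inv_eq_one.1 h).symm)
          (fun h => hms (by rw [← h]; group))
        rw [smul_smul] at this
        simpa using this
    refine exists_tsum_sq_le hι (fun (ξ : L2 G) x => ‖ξ x‖) L2.summable_norm_sq
      (fun ξ => ‖L2n.convolve ι (b.coeffs ρ) ξ‖ ^ 2) hs
      (key s₁ (fun h => hs (by simp [h])) hm₁) (key s₂ (fun h => hs (by simp [h])) hm₂)
      |>.imp fun C hC ξ => ?_
    rw [L2.norm_sq_eq]
    exact hC ξ

/-- Elements of `U` are finite combinations of the chains `gρ`, which are the images of point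
masses; a closed range then also contains the closure of their span. -/
theorem hilbert_le_range (b : EdgeBasis Γ a H n) {ρ : Γ.Chain₁ a}
    {U : Submodule ℚ (Γ.Chain₁ a)} (hU : Generates ρ U)
    (hcl : IsClosed ((L2n.convolve (MonoidHom.id _) (b.coeffs ρ)).range :
      Set (L2n (Γ.π₁ a) n))) :
    hilbert b U ≤ (L2n.convolve (MonoidHom.id _) (b.coeffs ρ)).range := by
  classical
  refine Submodule.topologicalClosure_minimal _ (Submodule.span_le.2 ?_) hcl
  rintro _ ⟨x, hx, rfl⟩
  obtain ⟨q, rfl⟩ := hU.2 x hx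
  rw [Finsupp.sum]
  induction q.support using Finset.induction_on with
  | empty => simp only [Finset.sum_empty, b.coord_zero, SetLike.mem_coe, zero_mem]
  | insert g s hg ih =>
    rw [Finset.sum_insert hg, b.coord_add, b.coord_smul, ← b.convolve_single]
    exact add_mem (Submodule.smul_mem _ _ ⟨_, rfl⟩) ih

theorem convolve_single_mem_hilbert [DecidableEq (Γ.π₁ a)] (b : EdgeBasis Γ a H n)
    {ρ : Γ.Chain₁ a} {U : Submodule ℚ (Γ.Chain₁ a)} (hρ : ρ ∈ U)
    (hU : ∀ (g : Γ.π₁ a), ∀ x ∈ U, translate g x ∈ U) (g : Γ.π₁ a) :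
    L2n.convolve (MonoidHom.id _) (b.coeffs ρ) (lp.single 2 g 1) ∈ hilbert b U := by
  rw [b.convolve_single]
  exact Submodule.le_topologicalClosure _ (Submodule.subset_span ⟨_, hU g ρ hρ, rfl⟩)

theorem hilbert_bot (b : EdgeBasis Γ a H n) : hilbert b (⊥ : Submodule ℚ (Γ.Chain₁ a)) = ⊥ := by
  rw [hilbert, Submodule.bot_coe, Set.image_singleton, b.coord_zero, Submodule.span_zero_singleton]
  exact isClosed_singleton.submodule_topologicalClosure_eq

end CellGraph

/-! ### Induction to the free-by-cyclic group -/

theorem inducedModule_bot {F : Type*} [Group F] (Φ : MulAut F) (n : ℕ) :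
    inducedModule Φ (⊥ : Submodule ℂ (L2n F n)) = ⊥ := by
  simp only [inducedModule, Submodule.map_bot, iSup_bot]
  exact isClosed_singleton.submodule_topologicalClosure_eq

/-- Convolution commutes with the left action of `t ^ ℓ` and with extension by zero, so each summand
`t^ℓ U` consists of images. -/
theorem inducedModule_le_range {F : Type*} [Group F] (Φ : MulAut F) {n : ℕ}
    {U : Submodule ℂ (L2n F n)} {r : Fin n → F →₀ ℂ}
    (hU : U ≤ (L2n.convolve (MonoidHom.id F) r).range)
    (hcl : IsClosed ((L2n.convolve (SemidirectProduct.inl : F →* FreeByCyclic Φ) r).range :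
      Set (L2n (FreeByCyclic Φ) n))) :
    inducedModule Φ U ≤ (L2n.convolve (SemidirectProduct.inl : F →* FreeByCyclic Φ) r).range := by
  refine Submodule.topologicalClosure_minimal _ (iSup_le fun ℓ => ?_) hcl
  rintro _ ⟨_, ⟨x, hx, rfl⟩, rfl⟩
  obtain ⟨ξ, rfl⟩ := hU hx
  refine ⟨L2.act (FreeByCyclic.t Φ ^ ℓ) (L2.ext _ SemidirectProduct.inl_injective ξ), ?_⟩
  exact (L2n.convolve_act _ _ _ _).trans (congrArg _ (L2n.convolve_ext _ _ _))

theorem FreeByCyclic.exists_eq_zpow_mul_inl {F : Type*} [Group F] (Φ : MulAut F)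
    (x : FreeByCyclic Φ) :
    ∃ (ℓ : ℤ) (g : F), x = FreeByCyclic.t Φ ^ ℓ * SemidirectProduct.inl g := by
  -- The normal form has the cyclic factor on the right; moving it to the left twists the `F`-part
  -- by the inverse action.
  refine ⟨x.right.toAdd, (zpowersHom (MulAut F) Φ⁻¹ x.right)⁻¹ x.left, ?_⟩
  have ht : FreeByCyclic.t Φ ^ x.right.toAdd = SemidirectProduct.inr x.right := by
    rw [FreeByCyclic.t, ← map_zpow, ← ofAdd_zsmul]
    simp
  rw [ht]
  ext <;> simp

theorem convolve_single_mem_inducedModule {F : Type*} [Group F] (Φ : MulAut F) [DecidableEq F]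
    [DecidableEq (FreeByCyclic Φ)] {n : ℕ} {U : Submodule ℂ (L2n F n)} {r : Fin n → F →₀ ℂ}
    (hU : ∀ g, L2n.convolve (MonoidHom.id F) r (lp.single 2 g 1) ∈ U) (x : FreeByCyclic Φ) :
    L2n.convolve (SemidirectProduct.inl : F →* FreeByCyclic Φ) r (lp.single 2 x 1) ∈
      inducedModule Φ U := by
  obtain ⟨ℓ, g, rfl⟩ := FreeByCyclic.exists_eq_zpow_mul_inl Φ x
  rw [← L2.act_single, ← L2.ext_single SemidirectProduct.inl_injective, L2n.convolve_act,
    L2n.convolve_ext]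
  exact Submodule.le_topologicalClosure _ (Submodule.mem_iSup_of_mem ℓ
    (Submodule.mem_map_of_mem (Submodule.mem_map_of_mem (hU g))))


open Classical in
theorem mainTheorem5 {V E : Type*} [Finite V] [Finite E]
    (Γ : CellGraph V E) (hΓ : Γ.Connected)
    (f : Γ.SelfMap) (hf : f.IsHomotopyEquivalence)
    (a : V) (ha : f.onV a = a)
    (H : Γ.Subgraph) (hH : f.Preserves H)
    (n : ℕ) (b : CellGraph.EdgeBasis Γ a H n)
    (Vqf : Submodule ℚ (Γ.Chain₁ a)) (hVqf : CellGraph.IsQuasiFixed f ha H Vqf) :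
    (inducedModule (f.inducedAut hf ha) (CellGraph.hilbert b Vqf) ≠ ⊥ →
      ∃ O : L2 (FreeByCyclic (f.inducedAut hf ha)) ≃L[ℂ]
          inducedModule (f.inducedAut hf ha) (CellGraph.hilbert b Vqf),
        ∀ g ξ, (O (L2.act g ξ) : L2n (FreeByCyclic (f.inducedAut hf ha)) n) =
          L2n.act g (O ξ)) ∧
    ∀ ρ : Γ.Chain₁ a, CellGraph.IsNielsen f ha H ρ → CellGraph.Generates ρ Vqf →
      ∃ O : L2 (Γ.π₁ a) ≃L[ℂ] CellGraph.hilbert b Vqf,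
        (∀ g, (O (lp.single 2 g (1 : ℂ)) : L2n (Γ.π₁ a) n) =
          b.coord (CellGraph.translate g ρ)) ∧
        (∀ g ξ, (O (L2.act g ξ) : L2n (Γ.π₁ a) n) = L2n.act g (O ξ)) ∧
        ∃ D : ℝ, 1 ≤ D ∧ ∀ ξ, D⁻¹ * ‖ξ‖ ≤ ‖O ξ‖ ∧ ‖O ξ‖ ≤ D * ‖ξ‖ := by
  have hcl : IsClosed (CellGraph.hilbert b Vqf : Set (L2n (Γ.π₁ a) n)) :=
    Submodule.isClosed_topologicalClosure _
  refine ⟨fun hW => ?_, fun ρ hρ hgen => ?_⟩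
  -- A zero `Vqf` would induce the zero module, so a Nielsen generator exists.
  · have hV : Vqf ≠ ⊥ := by
      rintro rfl
      rw [CellGraph.hilbert_bot, inducedModule_bot] at hW
      exact hW rfl
    obtain ⟨ρ, hρ, hgen⟩ := hVqf.generated hV
    obtain ⟨C, hC⟩ := hρ.exists_norm_sq_le b (ι := MonoidHom.id _) Function.injective_id
    obtain ⟨C', hC'⟩ := hρ.exists_norm_sq_le b
      (ι := (SemidirectProduct.inl : _ →* FreeByCyclic (f.inducedAut hf ha)))
      SemidirectProduct.inl_injective
    have hsingle := CellGraph.convolve_single_mem_hilbert b hgen.1 hVqf.translate_mem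
    obtain ⟨O, hO⟩ := L2.exists_equiv _ hC hcl hsingle (CellGraph.hilbert_le_range b hgen)
    -- The isomorphism over `𝔽` shows that its whole Hilbert module, closure included, lies in the
    -- range of the convolution; the induced module needs this.
    have hle : CellGraph.hilbert b Vqf ≤
        (L2n.convolve (MonoidHom.id (Γ.π₁ a)) (b.coeffs ρ)).range := fun x hx =>
      ⟨O.symm ⟨x, hx⟩, (hO _).symm.trans (by rw [O.apply_symm_apply])⟩
    have hclW : IsClosed (inducedModule (f.inducedAut hf ha) (CellGraph.hilbert b Vqf) :
        Set (L2n (FreeByCyclic (f.inducedAut hf ha)) n)) :=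
      Submodule.isClosed_topologicalClosure _
    obtain ⟨O', hO'⟩ := L2.exists_equiv _ hC' hclW
      (convolve_single_mem_inducedModule (f.inducedAut hf ha) hsingle)
      (inducedModule_le_range _ hle)
    exact ⟨O', fun g ξ => by rw [hO', hO', L2n.convolve_act]⟩
  · obtain ⟨C, hC⟩ := hρ.exists_norm_sq_le b (ι := MonoidHom.id _) Function.injective_id
    obtain ⟨O, hO⟩ := L2.exists_equiv _ hC hcl
      (CellGraph.convolve_single_mem_hilbert b hgen.1 hVqf.translate_mem)
      (CellGraph.hilbert_le_range b hgen)
    refine ⟨O, fun g => by rw [hO, b.convolve_single],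
      fun g ξ => by rw [hO, hO, L2n.convolve_act], ?_⟩
    let D := max 1 (max ‖O.toContinuousLinearMap‖ ‖O.symm.toContinuousLinearMap‖)
    have hD : 1 ≤ D := le_max_left _ _
    refine ⟨D, hD, fun ξ => ⟨?_, ?_⟩⟩
    · rw [inv_mul_le_iff₀ (by positivity)]
      calc ‖ξ‖ = ‖O.symm.toContinuousLinearMap (O ξ)‖ := by simp
        _ ≤ ‖O.symm.toContinuousLinearMap‖ * ‖O ξ‖ := ContinuousLinearMap.le_opNorm _ _
        _ ≤ D * ‖O ξ‖ := by gcongr; exact (le_max_right _ _).trans (le_max_right _ _)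
    · calc ‖O ξ‖ ≤ ‖O.toContinuousLinearMap‖ * ‖ξ‖ :=
            O.toContinuousLinearMap.le_opNorm ξ
        _ ≤ D * ‖ξ‖ := by gcongr; exact (le_max_left _ _).trans (le_max_right _ _)
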